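/- Conventions: a theory is a set of sentences over a first-order signature $\Pi$; structures are non-empty. For a theory $\mathcal{T}$ and formulae $F,G$, $F\models_{\mathcal{T}}G$ means that every model of $\mathcal{T}$ and $F$ is a model of $G$. A theory is *universal* if it is axiomatized by universal sentences. - $\mathcal{T}$ has *ground interpolation* if for all ground (quantifier- and variable-free) formulae $A$ and $B$ over $\Pi$ extended with additional constants, such that $A\wedge B\models_{\mathcal{T}}\bot$, there is a ground formula $I$ over the extended signature such that every additional constant occurring in $I$ occurs both in $A$ and in $B$ (symbols of $\Pi$ may be used freely in $I$), $A\models_{\mathcal{T}}I$, and $B\wedge I\models_{\mathcal{T}}\bot$. - $\mathcal{T}$ *admits quantifier elimination* if every formula $\phi(x_1,\dots,x_n)$ over $\Pi$ ($n\ge 0$) is equivalent modulo $\mathcal{T}$ to a quantifier-free formula $\phi^*(x_1,\dots,x_n)$ over $\Pi$ (where $\bot$ counts as a quantifier-free formula). - $\mathcal{T}^*$ is a *model companion* of $\mathcal{T}$ (both over $\Pi$) if every model of $\mathcal{T}$ embeds into a model of $\mathcal{T}^*$ and vice versa, and $\mathcal{T}^*$ is model complete, i.e. all embeddings between models of $\mathcal{T}^*$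 are elementary. - $\mathcal{T}^*$ is a *model completion* of $\mathcal{T}$ if it is a model companion of $\mathcal{T}$ and, for every model $\mathcal{A}$ of $\mathcal{T}$, the theory $\mathcal{T}^*\cup\Delta(\mathcal{A})$ is complete, where the diagram $\Delta(\mathcal{A})$ is the set of all literals true in $\mathcal{A}$ over $\Pi$ extended with a constant naming each element of $\mathcal{A}$. (A theory is complete if it has a model and all its models are elementarily equivalent.) **Theorem.** Let $\mathcal{T}$ be a universal theory and let $\mathcal{T}^*$ be a model companion of $\mathcal{T}$. If $\mathcal{T}$ has ground interpolation, then $\mathcal{T}^*$ admits quantifier elimination and $\mathcal{T}^*$ is a model completion of $\mathcal{T}$. Moreover, $\mathcal{T}$ has ground interpolation if and only if $\mathcal{T}^*$ has ground interpolation. -/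

import Mathlib

open FirstOrder

universe u v w

namespace FirstOrder.Language

variable {L : Language.{u, v}}

/-- The additional constants (elements of `C`) given by a function symbol of the expansion `L[[C]]`
of `L`: a singleton for a new constant symbol, and nothing for a symbol of `L`. -/
def symbolNewConstants {C : Type w} : ∀ {n : ℕ}, L[[C]].Functions n → Set C
  | _, Sum.inl _ => ∅
  | 0, Sum.inr c => {c}
  | _ + 1, Sum.inr _ => ∅

/-- The additional constants occurring in a term over `L[[C]]`. -/
def Term.newConstants {C : Type w} {α : Type*} : L[[C]].Term α → Set C
  | .var _ => ∅
  | .func f ts => symbolNewConstants f ∪ ⋃ i, (ts i).newConstants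

/-- The additional constants occurring in a formula over `L[[C]]`. -/
def BoundedFormula.newConstants {C : Type w} {α : Type*} :
    ∀ {n : ℕ}, L[[C]].BoundedFormula α n → Set C
  | _, .falsum => ∅
  | _, .equal t₁ t₂ => t₁.newConstants ∪ t₂.newConstants
  | _, .rel _ ts => ⋃ i, (ts i).newConstants
  | _, .imp φ ψ => φ.newConstants ∪ ψ.newConstants
  | _, .all φ => φ.newConstants

/-- The diagram of a structure `M`: all literals over `L[[M]]` (atomic sentences and negations of
atomic sentences) that hold in `M`, each new constant being interpreted by the element it names. -/
def diagram (L : Language.{u, v}) (M : Type w) [L.Structure M] : L[[M]].Theory :=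
  {φ | (BoundedFormula.IsAtomic φ ∨
      ∃ ψ : L[[M]].Sentence, BoundedFormula.IsAtomic ψ ∧ φ = Formula.not ψ) ∧ M ⊨ φ}

namespace Theory

/-- A theory is universal if it is axiomatized by universal sentences, i.e. if it has the same
consequences as some set of universal sentences. -/
def IsUniversallyAxiomatized (T : L.Theory) : Prop :=
  ∃ U : L.Theory, U.IsUniversal ∧ (∀ φ ∈ U, T ⊨ᵇ φ) ∧ (∀ φ ∈ T, U ⊨ᵇ φ)

/-- Ground interpolation. The additional constants are drawn from the countable supply `ℕ`.
Ground formulas are quantifier-free sentences. The symbols of `L` may be used freely in the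
interpolant; the additional constants in it must occur in both `A` and `B`. -/
def HasGroundInterpolation (T : L.Theory) : Prop :=
  ∀ A B : L[[ℕ]].Sentence, BoundedFormula.IsQF A → BoundedFormula.IsQF B →
    (L.lhomWithConstants ℕ).onTheory T ∪ {A ⊓ B} ⊨ᵇ (⊥ : L[[ℕ]].Sentence) →
    ∃ I : L[[ℕ]].Sentence, BoundedFormula.IsQF I ∧
      BoundedFormula.newConstants I ⊆
        BoundedFormula.newConstants A ∩ BoundedFormula.newConstants B ∧
      (L.lhomWithConstants ℕ).onTheory T ∪ {A} ⊨ᵇ I ∧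
      (L.lhomWithConstants ℕ).onTheory T ∪ {B ⊓ I} ⊨ᵇ (⊥ : L[[ℕ]].Sentence)

/-- Every formula in finitely many free variables (possibly none) is equivalent modulo `T` to a
quantifier-free formula in the same free variables. -/
def HasQuantifierElimination (T : L.Theory) : Prop :=
  ∀ (n : ℕ) (φ : L.Formula (Fin n)), ∃ ψ : L.Formula (Fin n),
    BoundedFormula.IsQF ψ ∧ φ ⇔[T] ψ

/-- All embeddings between models of `T` are elementary. -/
def IsModelComplete (T : L.Theory) : Prop :=
  ∀ (M N : ModelType.{u, v, max u v} T) (f : M ↪[L] N), ∃ g : M ↪ₑ[L] N, (g : M → N) = f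

/-- Every model of each of the two theories embeds into a model of the other one. -/
def AreCoTheories (T₁ T₂ : L.Theory) : Prop :=
  (∀ M : ModelType.{u, v, max u v} T₁, ∃ N : ModelType.{u, v, max u v} T₂, Nonempty (M ↪[L] N)) ∧
  (∀ N : ModelType.{u, v, max u v} T₂, ∃ M : ModelType.{u, v, max u v} T₁, Nonempty (N ↪[L] M))

/-- `Tstar` is a model companion of `T`. -/
def IsModelCompanion (Tstar T : L.Theory) : Prop :=
  AreCoTheories T Tstar ∧ Tstar.IsModelComplete

/-- `Tstar` is a model completion of `T`: a model companion such that `Tstar` together with the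
diagram of any model of `T` is a complete theory. -/
def IsModelCompletion (Tstar T : L.Theory) : Prop :=
  IsModelCompanion Tstar T ∧
    ∀ M : ModelType.{u, v, max u v} T,
      ((L.lhomWithConstants M).onTheory Tstar ∪ L.diagram M).IsComplete

end Theory

end FirstOrder.Language

/-! Ground formulas with new constants are preserved and reflected by embeddings. Theories whose
models embed into each other's models therefore have the same ground entailments
(`AreCoTheories.ground_models`), and a ground interpolant for one is an interpolant for the other.
This gives the equivalence and moves interpolation to `Tstar`.

The core is `HasGroundInterpolation.realize_iff_of_isQF`, an amalgamation argument. Let tuples in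
two models satisfy the same quantifier-free formulas, and name the elements of both models,
identifying the tuples. If the two diagrams were jointly inconsistent with the theory, finitely many
literals from each side would clash; an interpolant would be a quantifier-free formula of the tuple,
true on one side and false on the other. So both models embed over the tuple into a third one, and
model completeness makes these embeddings elementary.

Quantifier elimination follows by compactness. Completeness of `Tstar` with the diagram of `M`
follows by taking all of `M` as the tuple. -/

namespace FirstOrder.Language

variable {L : Language.{u, v}}

/-! ### Exchanging variables and new constants -/

/-- A term can be made closed by putting new constants in place of its variables. -/
theorem Term.exists_newConstants_subset_image {γ : Type*} {C : Type w} (t : L.Term (γ ⊕ Fin 0)) :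
    ∃ s : Set γ, s.Finite ∧ ∀ e : γ → C, ∃ t' : L[[C]].Term (Empty ⊕ Fin 0),
      t'.newConstants ⊆ e '' s ∧
      ∀ (M : Type (max u v)) [L.Structure M] [(constantsOn C).Structure M] (w : γ ⊕ Fin 0 → M)
        (z : Empty ⊕ Fin 0 → M), (∀ x ∈ s, (L.con (e x) : M) = w (Sum.inl x)) →
          t'.realize z = t.realize w := by
  induction t with
  | var x =>
    rcases x with x | x
    · refine ⟨{x}, Set.finite_singleton x, fun e => ⟨(L.con (e x)).term, ?_, ?_⟩⟩
      · simp only [Constants.term, Language.con, Term.newConstants, Set.iUnion_of_empty,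
          Set.union_empty, Set.image_singleton]
        exact subset_rfl
      · intro M _ _ w z h
        simpa using h x rfl
    · exact x.elim0
  | func f ts ih =>
    choose s hs h using ih
    refine ⟨⋃ i, s i, Set.finite_iUnion hs, fun e => ?_⟩
    choose t' ht' hr using fun i => h i e
    refine ⟨.func (Sum.inl f) t', ?_, ?_⟩
    · simp only [Term.newConstants, symbolNewConstants, Set.empty_union, Set.image_iUnion]
      exact Set.iUnion_mono ht'
    · intro M _ _ w z hw
      simp only [Term.realize, withConstants_funMap_sumInl]
      congr 1
      funext i
      exact hr i M w z fun x hx => hw x (Set.mem_iUnion_of_mem i hx)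

/-- A quantifier-free formula can be made ground by putting new constants in place of its
variables. -/
theorem BoundedFormula.IsQF.exists_newConstants_subset_image {γ : Type*} {C : Type w}
    {A : L.Formula γ} (hA : BoundedFormula.IsQF A) :
    ∃ s : Set γ, s.Finite ∧ ∀ e : γ → C, ∃ A' : L[[C]].Sentence, BoundedFormula.IsQF A' ∧
      BoundedFormula.newConstants A' ⊆ e '' s ∧
      ∀ (M : Type (max u v)) [L.Structure M] [(constantsOn C).Structure M] (w : γ → M),
        (∀ x ∈ s, (L.con (e x) : M) = w x) → (M ⊨ A' ↔ A.Realize w) := by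
  induction hA with
  | falsum =>
    exact ⟨∅, Set.finite_empty, fun e => ⟨⊥, isQF_bot, by
      simp [BoundedFormula.newConstants], fun M _ _ w _ => Iff.rfl⟩⟩
  | of_isAtomic h =>
    cases h with
    | equal t₁ t₂ =>
      obtain ⟨s₁, hs₁, h₁⟩ := t₁.exists_newConstants_subset_image (C := C)
      obtain ⟨s₂, hs₂, h₂⟩ := t₂.exists_newConstants_subset_image (C := C)
      refine ⟨s₁ ∪ s₂, hs₁.union hs₂, fun e => ?_⟩
      obtain ⟨t₁', hc₁, hr₁⟩ := h₁ e
      obtain ⟨t₂', hc₂, hr₂⟩ := h₂ e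
      refine ⟨t₁'.bdEqual t₂', (IsAtomic.equal _ _).isQF, ?_, ?_⟩
      · simp only [Term.bdEqual, BoundedFormula.newConstants, Set.image_union]
        exact Set.union_subset_union hc₁ hc₂
      · intro M _ _ w hw
        simp only [Sentence.Realize, Formula.Realize, realize_bdEqual]
        rw [hr₁ M (Sum.elim w default) _ fun x hx => hw x (Or.inl hx),
          hr₂ M (Sum.elim w default) _ fun x hx => hw x (Or.inr hx)]
    | rel R ts =>
      choose s hs h using fun i => (ts i).exists_newConstants_subset_image (C := C)
      refine ⟨⋃ i, s i, Set.finite_iUnion hs, fun e => ?_⟩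
      choose t' ht' hr using fun i => h i e
      refine ⟨Relations.boundedFormula (L := L[[C]]) (Sum.inl R) t', (IsAtomic.rel _ _).isQF,
        ?_, ?_⟩
      · simp only [Relations.boundedFormula, BoundedFormula.newConstants, Set.image_iUnion]
        exact Set.iUnion_mono ht'
      · intro M _ _ w hw
        simp only [Sentence.Realize, Formula.Realize, realize_rel]
        refine (iff_of_eq (withConstants_relMap_sumInl L)).trans
          (iff_of_eq (congrArg (Structure.RelMap R) (funext fun i => ?_)))
        exact hr i M (Sum.elim w default) _ fun x hx => hw x (Set.mem_iUnion_of_mem i hx)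
  | imp _ _ ih₁ ih₂ =>
    obtain ⟨s₁, hs₁, h₁⟩ := ih₁
    obtain ⟨s₂, hs₂, h₂⟩ := ih₂
    refine ⟨s₁ ∪ s₂, hs₁.union hs₂, fun e => ?_⟩
    obtain ⟨A₁, hq₁, hc₁, hr₁⟩ := h₁ e
    obtain ⟨A₂, hq₂, hc₂, hr₂⟩ := h₂ e
    refine ⟨A₁.imp A₂, hq₁.imp hq₂, ?_, ?_⟩
    · simp only [BoundedFormula.newConstants, Set.image_union]
      exact Set.union_subset_union hc₁ hc₂
    · intro M _ _ w hw
      exact imp_congr (hr₁ M w fun x hx => hw x (Or.inl hx))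
        (hr₂ M w fun x hx => hw x (Or.inr hx))

/-- In a closed term, the new constants can be replaced by variables. -/
theorem Term.exists_realize_eq_of_newConstants {α : Type*} {C : Type w} {K : Set C} (h : K → α)
    (t : L[[C]].Term (Empty ⊕ Fin 0)) (ht : t.newConstants ⊆ K) :
    ∃ t' : L.Term (α ⊕ Fin 0), ∀ (M : Type (max u v)) [L.Structure M]
      [(constantsOn C).Structure M] (w : α ⊕ Fin 0 → M) (z : Empty ⊕ Fin 0 → M),
        (∀ c : K, (L.con (c : C) : M) = w (Sum.inl (h c))) → t.realize z = t'.realize w := by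
  induction t with
  | var x => exact (IsEmpty.false x).elim
  | @func l f ts ih =>
    rw [Term.newConstants, Set.union_subset_iff, Set.iUnion_subset_iff] at ht
    choose t' hr using fun i => ih i (ht.2 i)
    match l, f with
    | _, Sum.inl f =>
      refine ⟨.func f t', fun M _ _ w z hw => ?_⟩
      simp only [Term.realize, withConstants_funMap_sumInl]
      congr 1
      funext i
      exact hr i M w z hw
    | 0, Sum.inr c =>
      refine ⟨.var (Sum.inl (h ⟨c, ht.1 rfl⟩)), fun M _ _ w z hw => ?_⟩
      exact (withConstants_funMap_sumInr L C).trans (hw ⟨c, _⟩)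
    | _ + 1, Sum.inr c => exact isEmptyElim c

/-- In a ground formula, the new constants can be replaced by variables. -/
theorem BoundedFormula.IsQF.exists_realize_iff_of_newConstants {α : Type*} {C : Type w} {K : Set C}
    (h : K → α) {I : L[[C]].Sentence} (hI : BoundedFormula.IsQF I)
    (hK : BoundedFormula.newConstants I ⊆ K) :
    ∃ ψ : L.Formula α, BoundedFormula.IsQF ψ ∧ ∀ (M : Type (max u v)) [L.Structure M]
      [(constantsOn C).Structure M] (w : α → M),
        (∀ c : K, (L.con (c : C) : M) = w (h c)) → (M ⊨ I ↔ ψ.Realize w) := by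
  induction hI with
  | falsum => exact ⟨⊥, isQF_bot, fun M _ _ w _ => Iff.rfl⟩
  | of_isAtomic hI =>
    cases hI with
    | equal t₁ t₂ =>
      simp only [Term.bdEqual, BoundedFormula.newConstants, Set.union_subset_iff] at hK
      obtain ⟨t₁', h₁⟩ := t₁.exists_realize_eq_of_newConstants h hK.1
      obtain ⟨t₂', h₂⟩ := t₂.exists_realize_eq_of_newConstants h hK.2
      refine ⟨t₁'.bdEqual t₂', (IsAtomic.equal _ _).isQF, fun M _ _ w hw => ?_⟩
      simp only [Sentence.Realize, Formula.Realize, realize_bdEqual]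
      rw [h₁ M (Sum.elim w default) _ hw, h₂ M (Sum.elim w default) _ hw]
    | @rel l R ts =>
      simp only [Relations.boundedFormula, BoundedFormula.newConstants,
        Set.iUnion_subset_iff] at hK
      choose t' hr using fun i => (ts i).exists_realize_eq_of_newConstants h (hK i)
      rcases R with R | R
      · refine ⟨R.boundedFormula t', (IsAtomic.rel _ _).isQF, fun M _ _ w hw => ?_⟩
        simp only [Sentence.Realize, Formula.Realize, realize_rel]
        refine (iff_of_eq (withConstants_relMap_sumInl L)).trans
          (iff_of_eq (congrArg (Structure.RelMap R) (funext fun i => ?_)))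
        exact hr i M (Sum.elim w default) _ hw
      · exact isEmptyElim R
  | imp _ _ ih₁ ih₂ =>
    simp only [BoundedFormula.newConstants, Set.union_subset_iff] at hK
    obtain ⟨ψ₁, hq₁, h₁⟩ := ih₁ hK.1
    obtain ⟨ψ₂, hq₂, h₂⟩ := ih₂ hK.2
    exact ⟨ψ₁.imp ψ₂, hq₁.imp hq₂, fun M _ _ w hw => imp_congr (h₁ M w hw) (h₂ M w hw)⟩

/-! ### Valuations of constants and compactness -/

namespace Theory

/-- Entailment of sentences with new constants, over a theory without them, in terms of models of
the theory with a valuation of the constants. -/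
theorem onTheory_union_singleton_models_iff {C : Type} {T : L.Theory} {A F : L[[C]].Sentence} :
    (L.lhomWithConstants C).onTheory T ∪ {A} ⊨ᵇ F ↔
      ∀ (M : Type (max u v)) [L.Structure M] [Nonempty M] [M ⊨ T] (v : C → M),
        (Formula.equivSentence.symm A).Realize v → (Formula.equivSentence.symm F).Realize v := by
  constructor
  · intro h M _ _ _ v hA
    let := constantsOn.structure v
    have hT : M ⊨ (L.lhomWithConstants C).onTheory T := (LHom.onTheory_model _ _).2 inferInstance
    have : M ⊨ (L.lhomWithConstants C).onTheory T ∪ {A} :=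
      hT.union ((Theory.model_singleton_iff).2 ((Formula.realize_equivSentence_symm M A v).1 hA))
    exact (Formula.realize_equivSentence_symm M F v).2 (h.realize_sentence M)
  · refine fun h => models_sentence_iff.2 fun M => ?_
    let := (L.lhomWithConstants C).reduct M
    have hT : M ⊨ T := (LHom.onTheory_model (L.lhomWithConstants C) _).1
      (M.is_model.mono Set.subset_union_left)
    have hA : M ⊨ A := M.is_model.realize_of_mem _ (Or.inr rfl)
    rw [← Formula.realize_equivSentence_symm_con] at hA ⊢
    exact h M _ hA

/-- Compactness for formulas: a directed set of formulas, each of which is realized in a model of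
`T`, is realized in a single model of `T`. -/
theorem exists_realize_of_directed {γ : Type w} (T : L.Theory) {P : Set (L.Formula γ)}
    (hne : P.Nonempty)
    (hdir : ∀ φ ∈ P, ∀ ψ ∈ P, ∃ θ ∈ P, ∀ (M : Type (max u v w)) [L.Structure M] (v : γ → M),
      θ.Realize v → φ.Realize v ∧ ψ.Realize v)
    (hP : ∀ φ ∈ P, ∃ (M : ModelType.{u, v, max u v w} T) (v : γ → M), φ.Realize v) :
    ∃ (M : ModelType.{u, v, max u v w} T) (v : γ → M), ∀ φ ∈ P, φ.Realize v := by
  -- `S θ` collects all consequences of `θ` modulo `T`, the variables being read as constants. It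
  -- contains `T` and `θ` themselves, and a stronger `θ` gives a larger `S θ`.
  let S : P → L[[γ]].Theory := fun θ => {σ | ∀ (M : ModelType.{u, v, max u v w} T) (v : γ → M),
    θ.1.Realize v → (Formula.equivSentence.symm σ).Realize v}
  have hS : Directed (· ⊆ ·) S := by
    rintro ⟨φ, hφ⟩ ⟨ψ, hψ⟩
    obtain ⟨θ, hθ, h⟩ := hdir φ hφ ψ hψ
    exact ⟨⟨θ, hθ⟩, fun σ hσ M v hv => hσ M v (h M v hv).1, fun σ hσ M v hv => hσ M v (h M v hv).2⟩
  have : Nonempty P := hne.to_subtype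
  have hsat : Theory.IsSatisfiable (⋃ θ, S θ) := by
    refine (isSatisfiable_directed_union_iff hS).2 ?_
    rintro ⟨θ, hθ⟩
    obtain ⟨M, v, hv⟩ := hP θ hθ
    let := constantsOn.structure v
    have : M ⊨ S ⟨θ, hθ⟩ := ⟨fun σ hσ => (Formula.realize_equivSentence_symm M σ v).1 (hσ M v hv)⟩
    exact Model.isSatisfiable M
  obtain ⟨K⟩ := hsat
  let := (L.lhomWithConstants γ).reduct K
  have hK : ∀ σ θ, σ ∈ S θ → (K : Type _) ⊨ σ := fun σ θ h =>
    K.is_model.realize_of_mem _ (Set.mem_iUnion_of_mem θ h)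
  have hT : K ⊨ T := by
    refine (LHom.onTheory_model (L.lhomWithConstants γ) _).1 ⟨?_⟩
    rintro _ ⟨τ, hτ, rfl⟩
    refine hK _ (Classical.arbitrary P) fun M v _ => ?_
    let := constantsOn.structure v
    rw [Formula.realize_equivSentence_symm, LHom.realize_onSentence]
    exact M.is_model.realize_of_mem _ hτ
  refine ⟨ModelType.of T K, fun a => (L.con a : K), fun φ hφ => ?_⟩
  have := hK (Formula.equivSentence φ) ⟨φ, hφ⟩ fun M v hv => by simpa using hv
  rwa [Formula.realize_equivSentence] at this

end Theory

/-! ### Embeddings and diagrams -/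

/-- Quantifier-free formulas are preserved and reflected by embeddings. -/
theorem BoundedFormula.IsQF.formula_realize_embedding {α : Type*} {ψ : L.Formula α}
    (hψ : BoundedFormula.IsQF ψ) {M N : Type*} [L.Structure M] [L.Structure N] (f : M ↪[L] N)
    (v : α → M) : ψ.Realize (f ∘ v) ↔ ψ.Realize v := by
  rw [Formula.Realize, Formula.Realize, ← hψ.realize_embedding f]
  exact iff_of_eq (congrArg _ (Subsingleton.elim _ _))

/-- Ground sentences with new constants are preserved and reflected by embeddings. -/
theorem BoundedFormula.IsQF.realize_equivSentence_symm_embedding {C : Type w} {A : L[[C]].Sentence}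
    (hA : BoundedFormula.IsQF A) {M N : Type (max u v)} [L.Structure M] [L.Structure N]
    (f : M ↪[L] N) (v : C → M) :
    (Formula.equivSentence.symm A).Realize (f ∘ v) ↔ (Formula.equivSentence.symm A).Realize v := by
  -- Turning every constant into a variable gives an `L`-formula, to which preservation under
  -- `L`-embeddings applies.
  obtain ⟨ψ, hψ, h⟩ := hA.exists_realize_iff_of_newConstants (K := Set.univ) (fun c => c.1)
    (Set.subset_univ _)
  have hN : (Formula.equivSentence.symm A).Realize (f ∘ v) ↔ ψ.Realize (f ∘ v) := by
    let := constantsOn.structure (f ∘ v)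
    exact (Formula.realize_equivSentence_symm N A _).trans (h N _ fun _ => rfl)
  have hM : (Formula.equivSentence.symm A).Realize v ↔ ψ.Realize v := by
    let := constantsOn.structure v
    exact (Formula.realize_equivSentence_symm M A _).trans (h M _ fun _ => rfl)
  rw [hN, hM, hψ.formula_realize_embedding]

/-- A map under which atomic formulas are preserved and reflected is an embedding. -/
theorem exists_embedding_of_isAtomic {M N : Type*} [L.Structure M] [L.Structure N] (j : M → N)
    (h : ∀ ψ : L.Formula M, BoundedFormula.IsAtomic ψ → (ψ.Realize id ↔ ψ.Realize j)) :
    ∃ F : M ↪[L] N, (F : M → N) = j := by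
  refine ⟨⟨⟨j, fun x y hxy => ?_⟩, fun {n} f x => ?_, fun {n} R x => ?_⟩, rfl⟩
  · have := h ((Term.var x).equal (Term.var y)) (.equal _ _)
    simp only [Formula.realize_equal, Term.realize_var] at this
    exact this.2 hxy
  · have := h ((Term.func f fun i => Term.var (x i)).equal (Term.var (Structure.funMap f x)))
      (.equal _ _)
    simp only [Formula.realize_equal, Term.realize] at this
    exact (this.1 rfl).symm
  · have := h (R.formula fun i => Term.var (x i)) (.rel _ _)
    simp only [Formula.realize_rel, Term.realize_var] at this
    exact this.symm

/-- Replacing variables by new constants in an atomic formula gives an atomic sentence. -/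
theorem BoundedFormula.IsAtomic.equivSentence {α : Type*} {φ : L.Formula α}
    (h : BoundedFormula.IsAtomic φ) : BoundedFormula.IsAtomic (Formula.equivSentence φ) := by
  cases h with
  | equal t₁ t₂ => exact .equal _ _
  | rel R ts => exact .rel _ _

/-- The interpretation of the new constants in a model of the diagram of `M` is an embedding. -/
theorem exists_embedding_of_models_diagram {M N : Type*} [L.Structure M] [L[[M]].Structure N]
    [L.Structure N] [(L.lhomWithConstants M).IsExpansionOn N] (h : N ⊨ L.diagram M) :
    ∃ F : M ↪[L] N, ∀ m, F m = (L.con m : N) := by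
  obtain ⟨F, hF⟩ := exists_embedding_of_isAtomic (L := L) (fun m : M => (L.con m : N))
    fun ψ hψ => by
      have hM : M ⊨ Formula.equivSentence ψ ↔ ψ.Realize (id : M → M) :=
        Formula.realize_equivSentence M ψ
      rw [← Formula.realize_equivSentence, ← hM]
      refine ⟨fun hm => h.realize_of_mem _ ⟨.inl hψ.equivSentence, hm⟩, fun hn => ?_⟩
      by_contra hm
      have := h.realize_of_mem (Formula.not (Formula.equivSentence ψ))
        ⟨.inr ⟨_, hψ.equivSentence, rfl⟩, hm⟩
      exact this hn
  exact ⟨F, fun m => congrFun hF m⟩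

/-- A structure into which `M` embeds is a model of the diagram of `M`. -/
theorem Embedding.models_diagram {M N : Type (max u v)} [L.Structure M] [L.Structure N] (F : M ↪[L] N) :
    @Theory.Model L[[M]] N (@withConstantsStructure L N _ M (constantsOn.structure F))
      (L.diagram M) := by
  let := constantsOn.structure F
  have key : ∀ σ : L[[M]].Sentence, BoundedFormula.IsAtomic σ → (N ⊨ σ ↔ M ⊨ σ) := by
    intro σ hσ
    have := hσ.isQF.realize_equivSentence_symm_embedding F (id : M → M)
    rwa [Formula.realize_equivSentence_symm, Formula.realize_equivSentence_symm] at this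
  refine ⟨?_⟩
  rintro φ ⟨hφ | ⟨ψ, hψ, rfl⟩, hM⟩
  · exact (key φ hφ).2 hM
  · exact fun hN => hM ((key ψ hψ).1 hN)

/-! ### Transfer of ground interpolation between co-theories -/

namespace Theory

theorem AreCoTheories.symm {T₁ T₂ : L.Theory} (h : AreCoTheories T₁ T₂) : AreCoTheories T₂ T₁ :=
  ⟨h.2, h.1⟩

/-- Co-theories have the same entailments between ground sentences with new constants. -/
theorem AreCoTheories.ground_models {T₁ T₂ : L.Theory} (h : AreCoTheories T₁ T₂)
    {A F : L[[ℕ]].Sentence} (hA : BoundedFormula.IsQF A) (hF : BoundedFormula.IsQF F)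
    (hAF : (L.lhomWithConstants ℕ).onTheory T₁ ∪ {A} ⊨ᵇ F) :
    (L.lhomWithConstants ℕ).onTheory T₂ ∪ {A} ⊨ᵇ F := by
  rw [onTheory_union_singleton_models_iff] at hAF ⊢
  intro M _ _ _ v hv
  -- `A` goes up to a model of `T₁`, where the entailment is known, and `F` comes back down.
  obtain ⟨N, ⟨f⟩⟩ := h.2 (ModelType.of T₂ M)
  exact (hF.realize_equivSentence_symm_embedding f v).1
    (hAF N _ ((hA.realize_equivSentence_symm_embedding f v).2 hv))

/-- Ground interpolation is shared by co-theories. -/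
theorem AreCoTheories.hasGroundInterpolation {T₁ T₂ : L.Theory} (h : AreCoTheories T₁ T₂)
    (hT : T₁.HasGroundInterpolation) : T₂.HasGroundInterpolation := by
  intro A B hA hB hAB
  obtain ⟨I, hI, hc, hAI, hBI⟩ := hT A B hA hB (h.symm.ground_models (hA.inf hB) .falsum hAB)
  exact ⟨I, hI, hc, h.ground_models hA hI hAI, h.ground_models (hB.inf hI) .falsum hBI⟩

/-! ### Interpolation over arbitrary variables -/

/-- A valuation can be transported along a map that is injective on the relevant variables. -/
theorem exists_extension_of_injOn {γ : Type*} {M : Type*} [Nonempty M] {s : Set γ} {f : γ → ℕ}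
    (hf : s.InjOn f) (v : γ → M) : ∃ c : ℕ → M, ∀ x ∈ s, c (f x) = v x :=
  ⟨Function.extend (fun x : s => f x) (fun x => v x) fun _ => Classical.arbitrary M,
    fun x hx => (Set.injOn_iff_injective.1 hf).extend_apply _ _ (⟨x, hx⟩ : s)⟩

/-- Ground interpolation for quantifier-free formulas with arbitrary types of variables. -/
theorem HasGroundInterpolation.exists_interpolant {T : L.Theory} (hT : T.HasGroundInterpolation)
    {α β₁ β₂ : Type*} {A : L.Formula (α ⊕ β₁)} {B : L.Formula (α ⊕ β₂)}
    (hA : BoundedFormula.IsQF A) (hB : BoundedFormula.IsQF B)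
    (hAB : ∀ (M : ModelType.{u, v, max u v} T) (v : α ⊕ (β₁ ⊕ β₂) → M),
      A.Realize (v ∘ Sum.map id Sum.inl) → ¬ B.Realize (v ∘ Sum.map id Sum.inr)) :
    ∃ I : L.Formula α, BoundedFormula.IsQF I ∧
      (∀ (M : ModelType.{u, v, max u v} T) (v : α ⊕ β₁ → M),
        A.Realize v → I.Realize (v ∘ Sum.inl)) ∧
      ∀ (M : ModelType.{u, v, max u v} T) (v : α ⊕ β₂ → M),
        B.Realize v → ¬ I.Realize (v ∘ Sum.inl) := by
  let ι₁ : α ⊕ β₁ → α ⊕ (β₁ ⊕ β₂) := Sum.map id Sum.inl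
  let ι₂ : α ⊕ β₂ → α ⊕ (β₁ ⊕ β₂) := Sum.map id Sum.inr
  have hι₁ : Function.Injective ι₁ := Function.injective_id.sumMap Sum.inl_injective
  have hι₂ : Function.Injective ι₂ := Function.injective_id.sumMap Sum.inr_injective
  obtain ⟨s₁, hs₁, h₁⟩ := hA.exists_newConstants_subset_image (C := ℕ)
  obtain ⟨s₂, hs₂, h₂⟩ := hB.exists_newConstants_subset_image (C := ℕ)
  -- Only finitely many variables matter, so `ℕ` suffices however large the variable types are. One
  -- coding serves both formulas, so they share a constant only where they share a variable from
  -- `α`.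
  obtain ⟨e, he⟩ := Set.countable_iff_exists_injOn.1
    ((hs₁.image ι₁).union (hs₂.image ι₂)).countable
  have he₁ : s₁.InjOn (e ∘ ι₁) := fun x hx y hy hxy =>
    hι₁ (he (.inl ⟨x, hx, rfl⟩) (.inl ⟨y, hy, rfl⟩) hxy)
  have he₂ : s₂.InjOn (e ∘ ι₂) := fun x hx y hy hxy =>
    hι₂ (he (.inr ⟨x, hx, rfl⟩) (.inr ⟨y, hy, rfl⟩) hxy)
  obtain ⟨A', hA', hcA, hrA⟩ := h₁ (e ∘ ι₁)
  obtain ⟨B', hB', hcB, hrB⟩ := h₂ (e ∘ ι₂)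
  obtain ⟨I', hI', hcI, hAI, hBI⟩ := hT A' B' hA' hB' <| by
    rw [onTheory_union_singleton_models_iff]
    intro M _ _ _ c hc
    let := constantsOn.structure c
    rw [Formula.realize_equivSentence_symm] at hc
    have hc' := BoundedFormula.realize_inf.1 hc
    exact (hAB (ModelType.of T M) (c ∘ e) ((hrA M _ fun _ _ => rfl).1 hc'.1)
      ((hrB M _ fun _ _ => rfl).1 hc'.2)).elim
  rw [onTheory_union_singleton_models_iff] at hAI hBI
  have hK : ∀ c : ↥(BoundedFormula.newConstants I'), ∃ a : α,
      Sum.inl a ∈ s₁ ∧ Sum.inl a ∈ s₂ ∧ e (Sum.inl a) = c := by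
    rintro ⟨c, hc⟩
    obtain ⟨x, hx, hxc⟩ := hcA (hcI hc).1
    obtain ⟨y, hy, hyc⟩ := hcB (hcI hc).2
    have hxy : ι₁ x = ι₂ y := he (.inl ⟨x, hx, rfl⟩) (.inr ⟨y, hy, rfl⟩) (hxc.trans hyc.symm)
    rcases x with a | b <;> rcases y with a' | b' <;> simp [ι₁, ι₂] at hxy
    subst hxy
    exact ⟨a, hx, hy, hxc⟩
  choose h hh₁ hh₂ hhe using hK
  obtain ⟨I, hI, hrI⟩ := hI'.exists_realize_iff_of_newConstants h subset_rfl
  refine ⟨I, hI, fun M v hv => ?_, fun M v hv hIv => ?_⟩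
  · obtain ⟨c, hc⟩ := exists_extension_of_injOn he₁ v
    have hAI' := hAI M c
    let := constantsOn.structure c
    rw [Formula.realize_equivSentence_symm, Formula.realize_equivSentence_symm] at hAI'
    refine (hrI M _ fun k => ?_).1 (hAI' ((hrA M v hc).2 hv))
    rw [← hhe k]
    exact hc _ (hh₁ k)
  · obtain ⟨c, hc⟩ := exists_extension_of_injOn he₂ v
    have hBI' := hBI M c
    let := constantsOn.structure c
    rw [Formula.realize_equivSentence_symm, Formula.realize_equivSentence_symm] at hBI'
    refine hBI' (BoundedFormula.realize_inf.2 ⟨(hrB M v hc).2 hv, (hrI M _ fun k => ?_).2 hIv⟩)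
    rw [← hhe k]
    exact hc _ (hh₂ k)

end Theory

/-! ### Amalgamation and quantifier elimination -/

/-- Relabelling the variables preserves quantifier-freeness. -/
theorem BoundedFormula.IsQF.formula_relabel {α β : Type*} {φ : L.Formula α}
    (h : BoundedFormula.IsQF φ) (g : α → β) : BoundedFormula.IsQF (φ.relabel g) :=
  IsQF.relabel (m := 0) (n := 0) h _

/-- A map under which quantifier-free formulas are preserved is an embedding. -/
theorem exists_embedding_of_isQF {M N : Type*} [L.Structure M] [L.Structure N] (j : M → N)
    (h : ∀ ψ : L.Formula M, BoundedFormula.IsQF ψ → ψ.Realize id → ψ.Realize j) :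
    ∃ F : M ↪[L] N, (F : M → N) = j :=
  exists_embedding_of_isAtomic j fun ψ hψ => ⟨h ψ hψ.isQF, fun hj => by
    by_contra hid
    exact h ψ.not hψ.isQF.not hid hj⟩

namespace Theory

/-- In the presence of ground interpolation and of model completeness, tuples that satisfy the same
quantifier-free formulas satisfy the same formulas. -/
theorem HasGroundInterpolation.realize_iff_of_isQF {T : L.Theory} (hT : T.HasGroundInterpolation)
    (hmc : T.IsModelComplete) {α : Type (max u v)} (M N : ModelType.{u, v, max u v} T)
    (f : α → M) (g : α → N)
    (hfg : ∀ ψ : L.Formula α, BoundedFormula.IsQF ψ → ψ.Realize f → ψ.Realize g)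
    (φ : L.Formula α) : φ.Realize f ↔ φ.Realize g := by
  let ι₁ : α ⊕ M → α ⊕ (M ⊕ N) := Sum.map id Sum.inl
  let ι₂ : α ⊕ N → α ⊕ (M ⊕ N) := Sum.map id Sum.inr
  -- The joint diagram of `M` and `N`. Its equations between a variable `a : α` and the names of `f
  -- a` and `g a` glue the two tuples together.
  let P : Set (L.Formula (α ⊕ (M ⊕ N))) := {θ | ∃ A : L.Formula (α ⊕ M), ∃ B : L.Formula (α ⊕ N),
    BoundedFormula.IsQF A ∧ BoundedFormula.IsQF B ∧ A.Realize (Sum.elim f id) ∧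
      B.Realize (Sum.elim g id) ∧ θ = A.relabel ι₁ ⊓ B.relabel ι₂}
  have hreal : ∀ (A : L.Formula (α ⊕ M)) (B : L.Formula (α ⊕ N)) (K : Type (max u v))
      [L.Structure K] (v : α ⊕ (M ⊕ N) → K), Formula.Realize (A.relabel ι₁ ⊓ B.relabel ι₂) v ↔
        A.Realize (v ∘ ι₁) ∧ B.Realize (v ∘ ι₂) := fun A B K _ v => by
    rw [Formula.realize_inf, Formula.realize_relabel, Formula.realize_relabel]
  obtain ⟨K, v, hv⟩ := exists_realize_of_directed T (P := P)
    ⟨_, ⊤, ⊤, .top, .top, Formula.realize_top.2 trivial, Formula.realize_top.2 trivial, rfl⟩ (by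
      rintro _ ⟨A, B, hA, hB, hAf, hBg, rfl⟩ _ ⟨A', B', hA', hB', hAf', hBg', rfl⟩
      refine ⟨_, ⟨A ⊓ A', B ⊓ B', hA.inf hA', hB.inf hB', Formula.realize_inf.2 ⟨hAf, hAf'⟩,
        Formula.realize_inf.2 ⟨hBg, hBg'⟩, rfl⟩, fun K _ v h => ?_⟩
      rw [hreal, Formula.realize_inf, Formula.realize_inf] at h
      rw [hreal, hreal]
      exact ⟨⟨h.1.1, h.2.1⟩, ⟨h.1.2, h.2.2⟩⟩) (by
      rintro _ ⟨A, B, hA, hB, hAf, hBg, rfl⟩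
      by_contra hcon
      obtain ⟨I, hI, hAI, hBI⟩ := hT.exists_interpolant hA hB fun K v hvA hvB =>
        hcon ⟨K, v, (hreal A B K v).2 ⟨hvA, hvB⟩⟩
      exact hBI N _ hBg (hfg I hI (hAI M _ hAf)))
  have hvM : ∀ A : L.Formula (α ⊕ M), BoundedFormula.IsQF A → A.Realize (Sum.elim f id) →
      A.Realize (v ∘ ι₁) := fun A hA hAf =>
    ((hreal A ⊤ K v).1 (hv _ ⟨A, ⊤, hA, .top, hAf, Formula.realize_top.2 trivial, rfl⟩)).1
  have hvN : ∀ B : L.Formula (α ⊕ N), BoundedFormula.IsQF B → B.Realize (Sum.elim g id) →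
      B.Realize (v ∘ ι₂) := fun B hB hBg =>
    ((hreal ⊤ B K v).1 (hv _ ⟨⊤, B, .top, hB, Formula.realize_top.2 trivial, hBg, rfl⟩)).2
  have key : ∀ (M' : ModelType.{u, v, max u v} T) (f' : α → M') (w : α ⊕ M' → K),
      (∀ A : L.Formula (α ⊕ M'), BoundedFormula.IsQF A → A.Realize (Sum.elim f' id) →
        A.Realize w) → (φ.Realize f' ↔ φ.Realize (w ∘ Sum.inl)) := by
    intro M' f' w hw
    obtain ⟨F, hF⟩ := exists_embedding_of_isQF (L := L) (fun m => w (Sum.inr m)) fun ψ hψ hid => by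
      have := hw _ (hψ.formula_relabel Sum.inr) (Formula.realize_relabel.2 hid)
      exact Formula.realize_relabel.1 this
    obtain ⟨G, hG⟩ := hmc M' K F
    rw [← G.map_formula φ f', hG, hF]
    refine iff_of_eq (congrArg _ (funext fun a => ?_))
    -- The gluing equation shows that the embedding sends `f' a` to the value of the shared variable
    -- `a`.
    have := hw ((Term.var (Sum.inl a)).equal (Term.var (Sum.inr (f' a))))
      (BoundedFormula.IsAtomic.equal _ _).isQF (by simp)
    simpa using this.symm
  exact (key M f _ hvM).trans (key N g _ hvN).symm

/-- Ground interpolation and model completeness imply quantifier elimination. -/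
theorem HasGroundInterpolation.hasQuantifierElimination {T : L.Theory}
    (hT : T.HasGroundInterpolation) (hmc : T.IsModelComplete) : T.HasQuantifierElimination := by
  intro n φ
  have hcore : ∀ (M N : ModelType.{u, v, max u v} T) (f : Fin n → M) (g : Fin n → N),
      (∀ ψ : L.Formula (Fin n), BoundedFormula.IsQF ψ → ψ.Realize f → ψ.Realize g) →
        φ.Realize f → φ.Realize g := by
    intro M N f g hfg hf
    -- The lift only puts `Fin n` into the universe of the models.
    have := (hT.realize_iff_of_isQF hmc (α := ULift.{max u v} (Fin n)) M N (f ∘ ULift.down)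
      (g ∘ ULift.down) (fun ψ hψ h => by
        have := hfg _ (hψ.formula_relabel ULift.down)
        rw [Formula.realize_relabel, Formula.realize_relabel] at this
        exact this h) (φ.relabel ULift.up))
    rw [Formula.realize_relabel, Formula.realize_relabel] at this
    exact this.1 hf
  by_contra hcon
  -- A realization of `P` satisfies all quantifier-free consequences of `φ`, but not `φ`. It exists
  -- because a consequence inconsistent with `φ.not` would be equivalent to `φ`.
  let P : Set (L.Formula (Fin n)) := {θ | ∃ ψ : L.Formula (Fin n), BoundedFormula.IsQF ψ ∧
    (∀ (M : ModelType.{u, v, max u v} T) (v : Fin n → M), φ.Realize v → ψ.Realize v) ∧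
      θ = ψ ⊓ φ.not}
  obtain ⟨N, g, hg⟩ := exists_realize_of_directed T (P := P)
    ⟨_, ⊤, .top, fun _ _ _ => Formula.realize_top.2 trivial, rfl⟩ (by
      rintro _ ⟨ψ, hψ, hφψ, rfl⟩ _ ⟨ψ', hψ', hφψ', rfl⟩
      refine ⟨_, ⟨ψ ⊓ ψ', hψ.inf hψ', fun M v hv =>
        Formula.realize_inf.2 ⟨hφψ M v hv, hφψ' M v hv⟩, rfl⟩, fun M _ v h => ?_⟩
      simp only [Formula.realize_inf] at h ⊢
      exact ⟨⟨h.1.1, h.2⟩, ⟨h.1.2, h.2⟩⟩) (by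
      rintro _ ⟨ψ, hψ, hφψ, rfl⟩
      by_contra hψφ
      refine hcon ⟨ψ, hψ, models_formula_iff.2 fun M v => ?_⟩
      refine BoundedFormula.realize_iff.2 ⟨hφψ M v, fun hv => ?_⟩
      by_contra hφ
      exact hψφ ⟨M, v, Formula.realize_inf.2 ⟨hv, hφ⟩⟩)
  have hgφ : ¬ φ.Realize g :=
    (Formula.realize_inf.1 (hg _ ⟨⊤, .top, fun _ _ _ => Formula.realize_top.2 trivial, rfl⟩)).2
  -- `φ` is consistent with the quantifier-free type of `g`: if it refuted some `ψ` in it, `ψ.not`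
  -- would be a consequence of `φ` and so hold at `g`.
  let Q : Set (L.Formula (Fin n)) := {θ | ∃ ψ : L.Formula (Fin n), BoundedFormula.IsQF ψ ∧
    ψ.Realize g ∧ θ = ψ ⊓ φ}
  obtain ⟨M, f, hf⟩ := exists_realize_of_directed T (P := Q)
    ⟨_, ⊤, .top, Formula.realize_top.2 trivial, rfl⟩ (by
      rintro _ ⟨ψ, hψ, hψg, rfl⟩ _ ⟨ψ', hψ', hψg', rfl⟩
      refine ⟨_, ⟨ψ ⊓ ψ', hψ.inf hψ', Formula.realize_inf.2 ⟨hψg, hψg'⟩, rfl⟩, fun M _ v h => ?_⟩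
      simp only [Formula.realize_inf] at h ⊢
      exact ⟨⟨h.1.1, h.2⟩, ⟨h.1.2, h.2⟩⟩) (by
      rintro _ ⟨ψ, hψ, hψg, rfl⟩
      by_contra hψφ
      have := hg _ ⟨ψ.not, hψ.not, fun M v hv hψv =>
        hψφ ⟨M, v, Formula.realize_inf.2 ⟨hψv, hv⟩⟩, rfl⟩
      exact (Formula.realize_inf.1 this).1 hψg)
  refine hgφ (hcore M N f g (fun ψ hψ hψf => ?_)
    (Formula.realize_inf.1 (hf _ ⟨⊤, .top, Formula.realize_top.2 trivial, rfl⟩)).2)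
  by_contra hψg
  exact (Formula.realize_inf.1 (hf _ ⟨ψ.not, hψ.not, hψg, rfl⟩)).1 hψf

/-! ### Model completion -/

/-- A model companion with ground interpolation is a model completion. -/
theorem IsModelCompanion.isModelCompletion {T Tstar : L.Theory} (h : Tstar.IsModelCompanion T)
    (hT : Tstar.HasGroundInterpolation) : Tstar.IsModelCompletion T := by
  refine ⟨h, fun M => ⟨?_, fun σ => ?_⟩⟩
  · obtain ⟨N, ⟨F⟩⟩ := h.1.1 M
    let := constantsOn.structure F
    have hN : N ⊨ (L.lhomWithConstants M).onTheory Tstar :=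
      (LHom.onTheory_model _ _).2 inferInstance
    have := hN.union F.models_diagram
    exact Model.isSatisfiable N
  · by_contra hcon
    rw [not_or, models_sentence_iff, models_sentence_iff] at hcon
    push Not at hcon
    obtain ⟨⟨K₁, h₁⟩, K₂, h₂⟩ := hcon
    have hK₂ : K₂ ⊨ σ := not_not.1 h₂
    let := (L.lhomWithConstants M).reduct K₁
    let := (L.lhomWithConstants M).reduct K₂
    have hT₁ : K₁ ⊨ Tstar := (LHom.onTheory_model (L.lhomWithConstants M) _).1
      (K₁.is_model.mono Set.subset_union_left)
    have hT₂ : K₂ ⊨ Tstar := (LHom.onTheory_model (L.lhomWithConstants M) _).1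
      (K₂.is_model.mono Set.subset_union_left)
    obtain ⟨F₁, hF₁⟩ := exists_embedding_of_models_diagram
      (K₁.is_model.mono (Set.subset_union_right (t := L.diagram M)))
    obtain ⟨F₂, hF₂⟩ := exists_embedding_of_models_diagram
      (K₂.is_model.mono (Set.subset_union_right (t := L.diagram M)))
    -- The tuples are the two copies of `M`; their quantifier-free formulas agree because both are
    -- evaluated in `M`.
    have key := hT.realize_iff_of_isQF h.2 (ModelType.of Tstar K₂) (ModelType.of Tstar K₁) F₂ F₁
      (fun ψ hψ hψ₂ => (hψ.formula_realize_embedding F₁ id).2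
        ((hψ.formula_realize_embedding F₂ id).1 hψ₂)) (Formula.equivSentence.symm σ)
    rw [funext hF₁, funext hF₂] at key
    exact h₁ ((Formula.realize_equivSentence_symm_con K₁ σ).1
      (key.1 ((Formula.realize_equivSentence_symm_con K₂ σ).2 hK₂)))

end Theory

end FirstOrder.Language

theorem mainTheorem10 {L : FirstOrder.Language.{u, v}} (T Tstar : L.Theory)
    (hT : T.IsUniversallyAxiomatized) (hcomp : Tstar.IsModelCompanion T) :
    (T.HasGroundInterpolation →
      Tstar.HasQuantifierElimination ∧ Tstar.IsModelCompletion T) ∧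
    (T.HasGroundInterpolation ↔ Tstar.HasGroundInterpolation) := by
  refine ⟨fun h => ?_, hcomp.1.hasGroundInterpolation, hcomp.1.symm.hasGroundInterpolation⟩
  -- Interpolation must first reach `Tstar`, the theory known to be model complete.
  have h' := hcomp.1.hasGroundInterpolation h
  exact ⟨h'.hasQuantifierElimination hcomp.2, hcomp.isModelCompletion h'⟩
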